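/- Let $S^1=\mathbb R/\mathbb Z$, let $J=\begin{pmatrix}0&-1\\1&0\end{pmatrix}$, let $F\colon S^1\times\mathbb R^2\to\mathbb R^2$ be a smooth ($C^\infty$) vector field, and let $C>0$ (for instance $C=1$). Let $X$ be the set of all $u\in C^1(\mathbb R\times S^1;\mathbb R^2)$ which satisfy the nonlinear Cauchy-Riemann equations $$u_s-J\bigl(u_t-F(t,u)\bigr)=0\qquad\text{on }\mathbb R\times S^1$$ and $|u(s,t)|\le C$ for all $(s,t)\in\mathbb R\times S^1$, where $|\cdot|$ is the Euclidean norm. Endow $X$ with the subspace topology of $C^0(\mathbb R\times S^1;\mathbb R^2)$ with the compact-open topology (the topology of uniform convergence on compact subsets). Then $X$ is a compact Hausdorff space. Moreover, if $u_n\in X$ for all $n\in\mathbb N$ and $u_n\to v$ uniformly on compact subsets of $\mathbb R\times S^1$ for some function $v\colon\mathbb R\times S^1\to\mathbb R^2$, then $v\in X$; in particular $v$ is again a $C^1$ solution. -/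

import Mathlib

open scoped ContDiff

/-- The Euclidean plane. -/
abbrev Plane : Type := EuclideanSpace ℝ (Fin 2)

/-- The cylinder `ℝ × S¹` with `S¹ = ℝ / ℤ`. -/
abbrev Cylinder : Type := ℝ × UnitAddCircle

/-- The symplectic matrix `J`, acting on the plane. -/
noncomputable def sympJ : Plane →ₗ[ℝ] Plane :=
  Matrix.toEuclideanLin !![(0 : ℝ), -1; 1, 0]

/-- A non-autonomous vector field `F(t, x)`, `t ∈ S¹`, is smooth if it is `C^∞` jointly in
`(t, x)`; functions on `S¹ = ℝ / ℤ` are differentiated after composition with the covering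
`ℝ → ℝ / ℤ`, which is a local diffeomorphism. -/
def IsSmoothField (F : UnitAddCircle → Plane → Plane) : Prop :=
  ContDiff ℝ ∞ (fun p : ℝ × Plane => F (p.1 : UnitAddCircle) p.2)

/-- `u` is a `C¹` function on the cylinder (tested on the covering `ℝ × ℝ → ℝ × S¹`). -/
def IsC1OnCylinder (u : Cylinder → Plane) : Prop :=
  ContDiff ℝ 1 (fun p : ℝ × ℝ => u (p.1, (p.2 : UnitAddCircle)))

/-- The partial derivative `u_s (s, t)`. -/
noncomputable def partialS (u : Cylinder → Plane) (s t : ℝ) : Plane :=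
  deriv (fun σ : ℝ => u (σ, (t : UnitAddCircle))) s

/-- The partial derivative `u_t (s, t)`. -/
noncomputable def partialT (u : Cylinder → Plane) (s t : ℝ) : Plane :=
  deriv (fun τ : ℝ => u (s, (τ : UnitAddCircle))) t

/-- `u` is a `C¹` solution of the nonlinear Cauchy-Riemann equations
`u_s - J (u_t - F(t, u)) = 0` with `|u| ≤ C` everywhere. -/
structure IsBoundedCRSolution (F : UnitAddCircle → Plane → Plane) (C : ℝ)
    (u : Cylinder → Plane) : Prop where
  contDiff : IsC1OnCylinder u
  equation : ∀ s t : ℝ,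
    partialS u s t - sympJ (partialT u s t - F (t : UnitAddCircle) (u (s, (t : UnitAddCircle)))) = 0
  bound : ∀ z : Cylinder, ‖u z‖ ≤ C

/-- The solution space `X`, a subset of `C⁰(ℝ × S¹; ℝ²)`; the latter carries the compact-open
topology, and `X` the subspace topology. -/
def solutionSpace (F : UnitAddCircle → Plane → Plane) (C : ℝ) : Set C(Cylinder, Plane) :=
  {u | IsBoundedCRSolution F C u}

open scoped Topology
open MeasureTheory Complex Filter

/-! In the coordinate `z = t + i s` the equation becomes `dbar U = G(t, U)`. Everything rests on a
priori `C^{1,1}` bounds for bounded solutions, obtained without singular integrals.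

If `‖dbar f‖ ≤ N`, a cone-weighted mean of `f` over a disc of radius `r` differs from the central
value by at most `r * N` (`norm_integral_cone_smul_sub_le`). For a difference `v = w(· + h) - w`,
the weighted mean is `O(‖h‖)` in terms of `sup ‖w‖` alone, as the translation can be moved onto the
cone. If `‖dbar v‖ ≤ A‖h‖ + B‖v‖`, a small `r` lets `sup ‖v‖` be absorbed
(`exists_lipschitz_bound_of_dbar_le`). Applied to `U` and then to its difference quotients, this
bounds first and second differences uniformly.

Hence pointwise limits of solutions are `C¹` solutions. Tychonoff gives compactness for pointwise
convergence, and equicontinuity upgrades it to the compact-open topology by Arzelà–Ascoli. -/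

/-! ### Circular means and `dbar`. -/

/-- Twice the Wirtinger derivative `∂f/∂z̄`. -/
noncomputable def dbar (f : ℂ → ℂ) (z : ℂ) : ℂ := fderiv ℝ f z 1 + I * fderiv ℝ f z I

/-- The map `η ↦ Df(η) + i Df(iη)` is conjugate-linear with value `dbar f` at `1`. For radial `η`,
the vector `iη` is tangent to the circle. -/
theorem fderiv_eq_dbar_sub (f : ℂ → ℂ) (z η : ℂ) :
    fderiv ℝ f z η = starRingEnd ℂ η * dbar f z - I * fderiv ℝ f z (I * η) := by
  have h (a b : ℝ) : fderiv ℝ f z (a + b * I) = a * fderiv ℝ f z 1 + b * fderiv ℝ f z I := by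
    have : (a + b * I : ℂ) = a • (1 : ℂ) + b • I := by simp
    rw [this, map_add, map_smul, map_smul]; simp
  have h1 := h η.re η.im
  have h2 := h (-η.im) η.re
  have e2 : ((-η.im : ℝ) : ℂ) + η.re * I = I * η := by
    apply Complex.ext <;> simp
  rw [Complex.re_add_im] at h1
  rw [e2] at h2
  have e3 : starRingEnd ℂ η = η.re - η.im * I := by
    apply Complex.ext <;> simp
  rw [h1, h2, dbar, e3]
  push_cast
  have alg (a b X Y : ℂ) : a * X + b * Y = (a - b * I) * (X + I * Y) - I * (-b * X + a * Y) := by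
    linear_combination (b * Y) * I_mul_I
  exact alg _ _ _ _

theorem hasDerivAt_mul_exp (ζ : ℂ) (α : ℝ) :
    HasDerivAt (fun α : ℝ => ζ * exp (α * I)) (I * (ζ * exp (α * I))) α := by
  have h : HasDerivAt (fun α : ℝ => (α : ℂ) * I) I α := by
    simpa using (Complex.ofRealCLM.hasDerivAt (x := α)).mul_const I
  have h2 := h.cexp.const_mul ζ
  rwa [show ζ * (exp (α * I) * I) = I * (ζ * exp (α * I)) by ring] at h2

/-- Up to the factor `x`, the integrand is the derivative of `f` along a closed circle. -/
theorem integral_fderiv_tangent_eq_zero {f : ℂ → ℂ} (hf : ContDiff ℝ 1 f) (z ζ : ℂ) {x : ℝ}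
    (hx : x ≠ 0) :
    ∫ α in (0 : ℝ)..2 * Real.pi,
      fderiv ℝ f (z + x * (ζ * exp (α * I))) (I * (ζ * exp (α * I))) = 0 := by
  have hd : ∀ α : ℝ, HasDerivAt (fun α : ℝ => f (z + x * (ζ * exp (α * I))))
      (x * fderiv ℝ f (z + x * (ζ * exp (α * I))) (I * (ζ * exp (α * I)))) α := by
    intro α
    have h1 := ((hf.differentiable one_ne_zero) (z + x * (ζ * exp (α * I)))).hasFDerivAt
    have h2 := ((hasDerivAt_mul_exp ζ α).const_mul (x : ℂ)).const_add z
    have h3 := h1.comp_hasDerivAt α h2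
    have h4 (D : ℂ →L[ℝ] ℂ) (y : ℂ) : D (x * y) = x * D y := by
      rw [← Complex.real_smul, map_smul, Complex.real_smul]
    rwa [h4] at h3
  have hc : Continuous fun α : ℝ =>
      (x : ℂ) * fderiv ℝ f (z + x * (ζ * exp (α * I))) (I * (ζ * exp (α * I))) := by
    have := hf.continuous_fderiv one_ne_zero
    fun_prop
  have h := intervalIntegral.integral_eq_sub_of_hasDerivAt (fun α _ => hd α)
    (hc.intervalIntegrable 0 (2 * Real.pi))
  rw [intervalIntegral.integral_const_mul] at h
  have e : exp ((2 * Real.pi : ℝ) * I) = exp ((0 : ℝ) * I) := by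
    push_cast; simp
  rw [e, sub_self] at h
  exact (mul_eq_zero.1 h).resolve_left (by exact_mod_cast hx)

/-- The circular means of a function deviate from its central value by at most the radius times
the supremum of `dbar`. -/
theorem norm_integral_circle_sub_le {f : ℂ → ℂ} (hf : ContDiff ℝ 1 f) {N : ℝ}
    (hN : ∀ z, ‖dbar f z‖ ≤ N) (z ζ : ℂ) :
    ‖∫ α in (0 : ℝ)..2 * Real.pi, (f (z + ζ * exp (α * I)) - f z)‖ ≤ 2 * Real.pi * (‖ζ‖ * N) := by
  have hf' := hf.continuous_fderiv one_ne_zero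
  have hdb : Continuous (dbar f) := by unfold dbar; fun_prop
  have hrad (α : ℝ) : f (z + ζ * exp (α * I)) - f z =
      ∫ x in (0 : ℝ)..1, fderiv ℝ f (z + x * (ζ * exp (α * I))) (ζ * exp (α * I)) := by
    have hd : ∀ x : ℝ, HasDerivAt (fun x : ℝ => f (z + x * (ζ * exp (α * I))))
        (fderiv ℝ f (z + x * (ζ * exp (α * I))) (ζ * exp (α * I))) x := by
      intro x
      have h1 := ((hf.differentiable one_ne_zero) (z + x * (ζ * exp (α * I)))).hasFDerivAt
      have h2 := ((Complex.ofRealCLM.hasDerivAt (x := x)).mul_const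
        (ζ * exp (α * I))).const_add z
      have h2' : HasDerivAt (fun x : ℝ => z + (x : ℂ) * (ζ * exp (α * I)))
        (ζ * exp (α * I)) x := by simpa using h2
      exact h1.comp_hasDerivAt x h2'
    have hc : Continuous fun x : ℝ =>
        fderiv ℝ f (z + x * (ζ * exp (α * I))) (ζ * exp (α * I)) := by fun_prop
    rw [intervalIntegral.integral_eq_sub_of_hasDerivAt (fun x _ => hd x)
      (hc.intervalIntegrable 0 1)]
    simp
  simp_rw [hrad]
  rw [intervalIntegral_intervalIntegral_swap]
  · have hin (x : ℝ) (hx : x ∈ Set.uIoc (0 : ℝ) 1) :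
        ‖∫ α in (0 : ℝ)..2 * Real.pi,
          fderiv ℝ f (z + x * (ζ * exp (α * I))) (ζ * exp (α * I))‖ ≤
          2 * Real.pi * (‖ζ‖ * N) := by
      rw [Set.uIoc_of_le zero_le_one] at hx
      -- The radial derivative becomes a `dbar` term plus a tangential term that integrates to zero.
      have e : (fun α : ℝ => fderiv ℝ f (z + x * (ζ * exp (α * I))) (ζ * exp (α * I))) =
          fun α : ℝ => starRingEnd ℂ (ζ * exp (α * I)) * dbar f (z + x * (ζ * exp (α * I))) -
            I * fderiv ℝ f (z + x * (ζ * exp (α * I))) (I * (ζ * exp (α * I))) := by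
        funext α
        exact fderiv_eq_dbar_sub _ _ _
      have c1 : Continuous fun α : ℝ => starRingEnd ℂ (ζ * exp (α * I)) *
          dbar f (z + x * (ζ * exp (α * I))) := by
        have := Complex.continuous_conj
        fun_prop
      have c2 : Continuous fun α : ℝ =>
          I * fderiv ℝ f (z + x * (ζ * exp (α * I))) (I * (ζ * exp (α * I))) := by fun_prop
      rw [e, intervalIntegral.integral_sub (c1.intervalIntegrable _ _)
        (c2.intervalIntegrable _ _), intervalIntegral.integral_const_mul,
        integral_fderiv_tangent_eq_zero hf z ζ hx.1.ne', mul_zero, sub_zero]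
      refine (intervalIntegral.norm_integral_le_of_norm_le_const (C := ‖ζ‖ * N) ?_).trans ?_
      · intro α _
        rw [norm_mul, RCLike.norm_conj, norm_mul, Complex.norm_exp_ofReal_mul_I, mul_one]
        gcongr
        exact hN _
      · rw [sub_zero, abs_of_nonneg (by positivity)]
        linarith
    simpa using intervalIntegral.norm_integral_le_of_norm_le_const hin
  · have hc : Continuous (Function.uncurry fun α x : ℝ =>
        fderiv ℝ f (z + x * (ζ * exp (α * I))) (ζ * exp (α * I))) := by
      unfold Function.uncurry
      fun_prop
    exact (hc.continuousOn.integrableOn_compact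
      (isCompact_uIcc.prod isCompact_uIcc)).mono_set
      (Set.prod_mono Set.uIoc_subset_uIcc Set.uIoc_subset_uIcc)

/-! ### Cone averages and the interior estimate. -/

/-- The cone of height and radius `r` over the origin. -/
noncomputable def cone (r : ℝ) (ζ : ℂ) : ℝ := max 0 (r - ‖ζ‖)

theorem continuous_cone (r : ℝ) : Continuous (cone r) := by unfold cone; fun_prop

theorem cone_nonneg (r : ℝ) (ζ : ℂ) : 0 ≤ cone r ζ := le_max_left _ _

theorem cone_eq_zero {r : ℝ} {ζ : ℂ} (h : r ≤ ‖ζ‖) : cone r ζ = 0 :=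
  max_eq_left (by linarith)

theorem abs_cone_sub_cone_le (r : ℝ) (ζ ξ : ℂ) : |cone r ζ - cone r ξ| ≤ ‖ζ - ξ‖ := by
  unfold cone
  refine (abs_max_sub_max_le_max _ _ _ _).trans ?_
  simp only [sub_self, abs_zero]
  refine max_le (norm_nonneg _) ?_
  rw [sub_sub_sub_cancel_left, abs_sub_comm]
  exact abs_norm_sub_norm_le ζ ξ

theorem hasCompactSupport_cone (r : ℝ) : HasCompactSupport (cone r) :=
  HasCompactSupport.intro (isCompact_closedBall 0 r) fun ζ hζ =>
    cone_eq_zero (by simpa using (not_le.1 (by simpa using hζ)).le)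

theorem integrable_cone_smul (r : ℝ) {g : ℂ → ℂ} (hg : Continuous g) :
    Integrable fun ζ => cone r ζ • g ζ :=
  ((continuous_cone r).smul hg).integrable_of_hasCompactSupport
    (hasCompactSupport_cone r).smul_right

theorem integrable_cone (r : ℝ) : Integrable (cone r) :=
  (continuous_cone r).integrable_of_hasCompactSupport (hasCompactSupport_cone r)

theorem integral_cone_pos {r : ℝ} (hr : 0 < r) : 0 < ∫ ζ, cone r ζ :=
  (continuous_cone r).integral_pos_of_hasCompactSupport_nonneg_nonzero
    (hasCompactSupport_cone r) (cone_nonneg r) (x := 0) (by simp [cone, hr.ne', hr.le])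

theorem integral_cone_smul_rotate (r : ℝ) (g : ℂ → ℂ) (α : ℝ) :
    ∫ ζ, cone r ζ • g (ζ * exp (α * I)) = ∫ ζ, cone r ζ • g ζ := by
  have h := ((rotation (Circle.exp α)).measurePreserving).integral_comp
    (rotation (Circle.exp α)).toHomeomorph.measurableEmbedding (fun ζ => cone r ζ • g ζ)
  rw [← h]
  congr 1
  funext ζ
  simp [rotation_apply, cone, mul_comm]

/-- Rotation invariance of the cone allows each value to be replaced by a circular mean, and on the
support `‖ζ‖ ≤ r`. -/
theorem norm_integral_cone_smul_sub_le {f : ℂ → ℂ} (hf : ContDiff ℝ 1 f) {N : ℝ}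
    (hN : ∀ z, ‖dbar f z‖ ≤ N) {r : ℝ} (z : ℂ) :
    ‖∫ ζ, cone r ζ • (f (z + ζ) - f z)‖ ≤ r * N * ∫ ζ, cone r ζ := by
  have hN0 : 0 ≤ N := (norm_nonneg _).trans (hN 0)
  have hfc := hf.continuous
  have hpi := Real.pi_pos
  have key : (2 * Real.pi) • ∫ ζ, cone r ζ • (f (z + ζ) - f z) =
      ∫ ζ, cone r ζ • ∫ α in (0 : ℝ)..2 * Real.pi, (f (z + ζ * exp (α * I)) - f z) := by
    calc (2 * Real.pi) • ∫ ζ, cone r ζ • (f (z + ζ) - f z)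
        = ∫ α in (0 : ℝ)..2 * Real.pi, ∫ ζ, cone r ζ • (f (z + ζ * exp (α * I)) - f z) := by
          simp_rw [integral_cone_smul_rotate r (fun ζ => f (z + ζ) - f z)]
          rw [intervalIntegral.integral_const, sub_zero]
      _ = ∫ ζ, ∫ α in (0 : ℝ)..2 * Real.pi, cone r ζ • (f (z + ζ * exp (α * I)) - f z) := by
          apply intervalIntegral_integral_swap
          have hc : Continuous (Function.uncurry fun (α : ℝ) (ζ : ℂ) =>
              cone r ζ • (f (z + ζ * exp (α * I)) - f z)) := by
            have := continuous_cone r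
            unfold Function.uncurry
            fun_prop
          have h1 := (hc.continuousOn.integrableOn_compact (μ := volume.prod volume)
            ((isCompact_uIcc (a := (0 : ℝ)) (b := 2 * Real.pi)).prod
              (isCompact_closedBall (0 : ℂ) r)))
          have h2 : IntegrableOn (Function.uncurry fun (α : ℝ) (ζ : ℂ) =>
              cone r ζ • (f (z + ζ * exp (α * I)) - f z))
              (Set.uIcc (0 : ℝ) (2 * Real.pi) ×ˢ Set.univ) (volume.prod volume) := by
            refine h1.of_forall_sdiff_eq_zero (measurableSet_uIcc.prod MeasurableSet.univ) ?_
            rintro ⟨α, ζ⟩ ⟨⟨hα, -⟩, hn⟩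
            have : r ≤ ‖ζ‖ := by
              by_contra! hlt
              exact hn ⟨hα, by simpa using hlt.le⟩
            simp [Function.uncurry, cone_eq_zero this]
          have h3 := h2.mono_set (Set.prod_mono Set.uIoc_subset_uIcc subset_rfl)
          rwa [IntegrableOn, ← Measure.prod_restrict, Measure.restrict_univ] at h3
      _ = _ := by simp_rw [intervalIntegral.integral_smul]
  have hb : ‖(2 * Real.pi) • ∫ ζ, cone r ζ • (f (z + ζ) - f z)‖ ≤
      ∫ ζ, cone r ζ * (2 * Real.pi * (r * N)) := by
    rw [key]
    refine norm_integral_le_of_norm_le ((integrable_cone r).mul_const _) (.of_forall fun ζ => ?_)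
    rw [norm_smul, Real.norm_of_nonneg (cone_nonneg r ζ)]
    rcases le_total r ‖ζ‖ with h | h
    · simp [cone_eq_zero h]
    · gcongr
      · exact cone_nonneg r ζ
      · refine (norm_integral_circle_sub_le hf hN z ζ).trans ?_
        gcongr
  rw [norm_smul, Real.norm_of_nonneg (by positivity), integral_mul_const] at hb
  have h2 : 2 * Real.pi * ‖∫ ζ, cone r ζ • (f (z + ζ) - f z)‖ ≤
      2 * Real.pi * (r * N * ∫ ζ, cone r ζ) := by linarith
  exact le_of_mul_le_mul_left h2 (by positivity)

/-- A change of variables puts the translation on the cone, which is 1-Lipschitz; the difference of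
cones lives on two discs. No derivative of `w` is needed. -/
theorem norm_integral_cone_smul_add_sub_le {w : ℂ → ℂ} (hw : Continuous w) {M : ℝ}
    (hM : ∀ z, ‖w z‖ ≤ M) {r : ℝ} (h z : ℂ) :
    ‖∫ ζ, cone r ζ • (w (z + ζ + h) - w (z + ζ))‖ ≤
      ‖h‖ * M * (2 * volume.real (Metric.closedBall (0 : ℂ) r)) := by
  have hM0 : 0 ≤ M := (norm_nonneg _).trans (hM 0)
  have e1 : ∫ ζ, cone r ζ • w (z + ζ + h) = ∫ ζ, cone r (ζ - h) • w (z + ζ) := by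
    rw [← integral_add_right_eq_self (fun ζ => cone r (ζ - h) • w (z + ζ)) h]
    simp [add_assoc]
  have i1 : Integrable fun ζ => cone r (ζ - h) • w (z + ζ) := by
    have := (integrable_cone_smul r (g := fun ζ => w (z + ζ + h)) (by fun_prop)).comp_sub_right h
    simpa [add_assoc] using this
  have i2 : Integrable fun ζ => cone r ζ • w (z + ζ) :=
    integrable_cone_smul r (by fun_prop)
  have e2 : ∫ ζ, cone r ζ • (w (z + ζ + h) - w (z + ζ)) =
      ∫ ζ in Metric.closedBall 0 r ∪ Metric.closedBall h r,
        (cone r (ζ - h) - cone r ζ) • w (z + ζ) := by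
    simp_rw [smul_sub]
    rw [integral_sub (integrable_cone_smul r (by fun_prop)) i2, e1, ← integral_sub i1 i2,
      setIntegral_eq_integral_of_forall_compl_eq_zero]
    · simp_rw [sub_smul]
    · intro ζ hζ
      simp only [Set.mem_union, Metric.mem_closedBall, not_or, not_le, dist_eq_norm,
        sub_zero] at hζ
      rw [cone_eq_zero hζ.1.le, cone_eq_zero hζ.2.le, sub_zero, zero_smul]
  have hfin (a : ℂ) : volume (Metric.closedBall a r) ≠ ⊤ := measure_closedBall_lt_top.ne
  have hvol : volume.real (Metric.closedBall (0 : ℂ) r ∪ Metric.closedBall h r) ≤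
      2 * volume.real (Metric.closedBall (0 : ℂ) r) := by
    refine (measureReal_union_le _ _).trans ?_
    rw [two_mul]
    refine add_le_add_right (le_of_eq ?_) _
    rw [measureReal_def, measureReal_def, Measure.addHaar_closedBall_center]
  rw [e2]
  refine (norm_setIntegral_le_of_norm_le_const (C := ‖h‖ * M)
    ((measure_union_lt_top (hfin 0).lt_top (hfin h).lt_top)) ?_).trans ?_
  · intro ζ _
    rw [norm_smul, Real.norm_eq_abs]
    gcongr
    · exact (abs_cone_sub_cone_le r _ _).trans (by simp)
    · exact hM _
  · gcongr

/-- Interior estimate: if `dbar` of a translation difference of a bounded function is controlled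
linearly by the step and the difference itself, then the function is Lipschitz in this step,
with a constant that depends on the bounds only. -/
theorem exists_lipschitz_bound_of_dbar_le {A B M : ℝ} (hA : 0 ≤ A) (hB : 0 ≤ B) (hM : 0 ≤ M) :
    ∃ K, 0 ≤ K ∧ ∀ w : ℂ → ℂ, ContDiff ℝ 1 w → (∀ z, ‖w z‖ ≤ M) → ∀ h : ℂ,
      (∀ z, ‖dbar (fun z => w (z + h) - w z) z‖ ≤ A * ‖h‖ + B * ‖w (z + h) - w z‖) →
      ∀ z, ‖w (z + h) - w z‖ ≤ K * ‖h‖ := by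
  -- This radius gives the supremum of the difference a coefficient at most `1 / 2`, so that it can
  -- be absorbed.
  obtain ⟨r, hr, hrB⟩ : ∃ r : ℝ, 0 < r ∧ r * B ≤ 1 / 2 := by
    refine ⟨1 / (2 * (B + 1)), by positivity, ?_⟩
    rw [div_mul_eq_mul_div, div_le_div_iff₀ (by positivity) (by norm_num)]
    linarith
  have hc := integral_cone_pos hr
  set c := ∫ ζ, cone r ζ
  set V := volume.real (Metric.closedBall (0 : ℂ) r)
  have hV : 0 ≤ V := measureReal_nonneg
  refine ⟨2 * (r * A + M * (2 * V) / c), by positivity, fun w hw hwM h hd => ?_⟩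
  set v : ℂ → ℂ := fun z => w (z + h) - w z with hv
  have hvc : ContDiff ℝ 1 v := (hw.comp (contDiff_id.add contDiff_const)).sub hw
  have improve (S : ℝ) (hS : ∀ z, ‖v z‖ ≤ S) (z : ℂ) :
      ‖v z‖ ≤ (r * A + M * (2 * V) / c) * ‖h‖ + S / 2 := by
    have hS0 : 0 ≤ S := (norm_nonneg _).trans (hS 0)
    have h1 := norm_integral_cone_smul_sub_le (r := r) hvc (N := A * ‖h‖ + B * S)
      (fun z => (hd z).trans (by gcongr; exact hS z)) z
    have h2 := norm_integral_cone_smul_add_sub_le (r := r) hw.continuous hwM h z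
    have hvcont := hvc.continuous
    have e : ∫ ζ, cone r ζ • (v (z + ζ) - v z) = (∫ ζ, cone r ζ • v (z + ζ)) - c • v z := by
      simp_rw [smul_sub]
      rw [integral_sub (integrable_cone_smul r (by fun_prop))
        (integrable_cone_smul r (by fun_prop)), integral_smul_const]
    have h3 : c * ‖v z‖ ≤ ‖h‖ * M * (2 * V) + r * (A * ‖h‖ + B * S) * c := by
      have : c • v z = (∫ ζ, cone r ζ • v (z + ζ)) -
          ∫ ζ, cone r ζ • (v (z + ζ) - v z) := by rw [e]; abel
      calc c * ‖v z‖ = ‖c • v z‖ := by rw [norm_smul, Real.norm_of_nonneg hc.le]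
        _ ≤ _ := by
          rw [this]
          exact (norm_sub_le _ _).trans (add_le_add h2 h1)
    have h4 : ‖v z‖ ≤ (‖h‖ * M * (2 * V) + r * (A * ‖h‖ + B * S) * c) / c := by
      rw [le_div_iff₀ hc]; linarith
    have h5 : (‖h‖ * M * (2 * V) + r * (A * ‖h‖ + B * S) * c) / c =
        (r * A + M * (2 * V) / c) * ‖h‖ + r * B * S := by
      field_simp
      ring
    have h6 := mul_le_mul_of_nonneg_right hrB hS0
    linarith
  -- Absorption requires a finite supremum, which the crude bound `2M` provides.
  have hbdd : BddAbove (Set.range fun z => ‖v z‖) := by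
    refine ⟨M + M, ?_⟩
    rintro _ ⟨z, rfl⟩
    exact (norm_sub_le _ _).trans (add_le_add (hwM _) (hwM _))
  have hsup := ciSup_le (improve (⨆ z, ‖v z‖) (le_ciSup hbdd))
  intro z
  have := le_ciSup hbdd z
  linarith

/-! ### Uniform bounds for time-periodic functions. -/

theorem apply_fract_of_periodic {E : Type*} {H : ℝ × ℂ → E}
    (hper : ∀ p : ℝ × ℂ, H (p + (1, 0)) = H p) (t : ℝ) (x : ℂ) : H (Int.fract t, x) = H (t, x) := by
  have h : Function.Periodic (fun t => H (t, x)) 1 := fun t => by simpa using hper (t, x)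
  simpa using h.sub_zsmul_eq (x := t) ⌊t⌋

theorem exists_norm_le_of_periodic {E : Type*} [NormedAddCommGroup E] {H : ℝ × ℂ → E}
    (hc : Continuous H) (hper : ∀ p : ℝ × ℂ, H (p + (1, 0)) = H p) (R : ℝ) :
    ∃ B, 0 ≤ B ∧ ∀ p : ℝ × ℂ, ‖p.2‖ ≤ R → ‖H p‖ ≤ B := by
  obtain ⟨B, hB⟩ := ((isCompact_Icc (a := (0 : ℝ)) (b := 1)).prod
    (isCompact_closedBall (0 : ℂ) R)).exists_bound_of_continuousOn hc.continuousOn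
  refine ⟨max B 0, le_max_right _ _, fun p hp => le_max_of_le_left ?_⟩
  rw [← apply_fract_of_periodic hper p.1 p.2]
  exact hB _ ⟨⟨Int.fract_nonneg _, (Int.fract_lt_one _).le⟩, by simpa using hp⟩

theorem fderiv_periodic {E : Type*} [NormedAddCommGroup E] [NormedSpace ℝ E] {H : ℝ × ℂ → E}
    (hper : ∀ p : ℝ × ℂ, H (p + (1, 0)) = H p) (p : ℝ × ℂ) :
    fderiv ℝ H (p + (1, 0)) = fderiv ℝ H p := by
  rw [← fderiv_comp_add_right]
  congr 1
  funext q
  exact hper q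

theorem exists_lipschitz_of_periodic {E : Type*} [NormedAddCommGroup E] [NormedSpace ℝ E]
    {H : ℝ × ℂ → E} (hH : ContDiff ℝ 1 H) (hper : ∀ p : ℝ × ℂ, H (p + (1, 0)) = H p) (R : ℝ) :
    ∃ B, 0 ≤ B ∧ ∀ p q : ℝ × ℂ, ‖p.2‖ ≤ R → ‖q.2‖ ≤ R → ‖H p - H q‖ ≤ B * ‖p - q‖ := by
  obtain ⟨B, hB0, hB⟩ := exists_norm_le_of_periodic (hH.continuous_fderiv one_ne_zero)
    (fderiv_periodic hper) R
  refine ⟨B, hB0, fun p q hp hq => ?_⟩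
  have hconv : Convex ℝ {p : ℝ × ℂ | ‖p.2‖ ≤ R} := by
    have := (convex_univ (𝕜 := ℝ) (E := ℝ)).prod (convex_closedBall (0 : ℂ) R)
    convert this using 1
    ext p
    simp
  exact hconv.norm_image_sub_le_of_norm_fderiv_le (fun x _ => hH.differentiable one_ne_zero x)
    (fun x hx => hB x hx) hq hp

/-- Second differences of a `C²` function that is periodic in time. -/
theorem exists_second_difference_bound {G : ℝ × ℂ → ℂ} (hG : ContDiff ℝ 2 G)
    (hper : ∀ p : ℝ × ℂ, G (p + (1, 0)) = G p) (R : ℝ) :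
    ∃ B, 0 ≤ B ∧ ∀ p a b d : ℝ × ℂ, ‖p.2‖ ≤ R → ‖a.2‖ ≤ R → ‖b.2‖ ≤ R → ‖d.2‖ ≤ R →
      ‖G d - G a - (G b - G p)‖ ≤ B * ‖d - a - (b - p)‖ + B * (‖b - p‖ * ‖a - p‖) := by
  -- The corner `a + (b - p)` of the parallelogram may leave the ball of radius `R`, but not that of
  -- radius `3R`.
  obtain ⟨B₁, hB₁0, hB₁⟩ := exists_lipschitz_of_periodic (hG.of_le one_le_two) hper (3 * R)
  have hG' : ContDiff ℝ 1 (fderiv ℝ G) := hG.fderiv_right (by norm_num)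
  obtain ⟨B₂, hB₂0, hB₂⟩ := exists_lipschitz_of_periodic hG' (fderiv_periodic hper) (3 * R)
  refine ⟨max B₁ B₂, le_max_of_le_left hB₁0, fun p a b d hp ha hb hd => ?_⟩
  have hR : 0 ≤ R := (norm_nonneg _).trans hp
  have hshift (x : ℝ × ℂ) (hx : ‖x.2‖ ≤ R) : ‖(x + (b - p)).2‖ ≤ 3 * R := by
    have h1 := norm_add_le x.2 (b.2 - p.2)
    have h2 := norm_sub_le b.2 p.2
    rw [Prod.snd_add, Prod.snd_sub]
    linarith
  have h1 : ‖G d - G (a + (b - p))‖ ≤ B₁ * ‖d - a - (b - p)‖ := by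
    rw [sub_sub]
    exact hB₁ _ _ (by linarith) (hshift a ha)
  have hconv : Convex ℝ {p : ℝ × ℂ | ‖p.2‖ ≤ R} := by
    have := (convex_univ (𝕜 := ℝ) (E := ℝ)).prod (convex_closedBall (0 : ℂ) R)
    convert this using 1
    ext p
    simp
  have hGd : Differentiable ℝ G := hG.differentiable two_ne_zero
  -- For the exact parallelogram, the mean value inequality is applied to `x ↦ G (x + (b - p)) - G
  -- x`.
  have h2 : ‖(G (a + (b - p)) - G a) - (G (p + (b - p)) - G p)‖ ≤ B₂ * ‖b - p‖ * ‖a - p‖ := by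
    refine hconv.norm_image_sub_le_of_norm_fderiv_le (𝕜 := ℝ)
      (f := fun x => G (x + (b - p)) - G x) (fun x _ => by fun_prop) (fun x hx => ?_) hp ha
    rw [fderiv_fun_sub (by fun_prop) (by fun_prop), fderiv_comp_add_right]
    simpa using hB₂ _ _ (hshift x hx) (le_trans hx (by linarith))
  rw [add_sub_cancel] at h2
  calc ‖G d - G a - (G b - G p)‖
      = ‖(G d - G (a + (b - p))) + ((G (a + (b - p)) - G a) - (G b - G p))‖ := by
        congr 1; ring
    _ ≤ B₁ * ‖d - a - (b - p)‖ + B₂ * ‖b - p‖ * ‖a - p‖ :=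
        (norm_add_le _ _).trans (add_le_add h1 h2)
    _ ≤ _ := by
        rw [mul_assoc]
        gcongr
        · exact le_max_left _ _
        · exact le_max_right _ _

/-! ### A priori bounds for solutions. -/

theorem dbar_add_right_sub {f : ℂ → ℂ} (hf : Differentiable ℝ f) (h z : ℂ) :
    dbar (fun z => f (z + h) - f z) z = dbar f (z + h) - dbar f z := by
  unfold dbar
  rw [fderiv_fun_sub (by fun_prop) (by fun_prop), fderiv_comp_add_right]
  simp only [sub_apply]
  ring

theorem dbar_const_smul {f : ℂ → ℂ} (hf : Differentiable ℝ f) (c : ℝ) (z : ℂ) :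
    dbar (fun z => c • f z) z = c • dbar f z := by
  unfold dbar
  rw [fderiv_fun_const_smul (hf z)]
  simp only [smul_apply, smul_add, mul_smul_comm]

/-- Bounded `C¹` solutions of `U_t + i U_s = G(t, U)` in the complex coordinate `t + i s`. -/
structure IsBoundedDbarSolution (G : ℝ × ℂ → ℂ) (C : ℝ) (U : ℂ → ℂ) : Prop where
  contDiff : ContDiff ℝ 1 U
  equation : ∀ z, dbar U z = G (z.re, U z)
  bound : ∀ z, ‖U z‖ ≤ C

theorem exists_lipschitz_bound_of_solution {G : ℝ × ℂ → ℂ} (hG : ContDiff ℝ 2 G)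
    (hper : ∀ p : ℝ × ℂ, G (p + (1, 0)) = G p) {C : ℝ} (hC : 0 ≤ C) :
    ∃ L, 0 ≤ L ∧ ∀ U, IsBoundedDbarSolution G C U → ∀ h z, ‖U (z + h) - U z‖ ≤ L * ‖h‖ := by
  obtain ⟨B, hB0, hB⟩ := exists_lipschitz_of_periodic (hG.of_le one_le_two) hper C
  obtain ⟨L, hL0, hL⟩ := exists_lipschitz_bound_of_dbar_le hB0 hB0 hC
  refine ⟨L, hL0, fun U hU h => hL U hU.contDiff hU.bound h fun z => ?_⟩
  rw [dbar_add_right_sub (hU.contDiff.differentiable one_ne_zero), hU.equation, hU.equation,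
    ← mul_add]
  refine (hB _ _ (hU.bound _) (hU.bound _)).trans ?_
  gcongr
  rw [Prod.norm_def]
  refine max_le ?_ ?_
  · have : ‖h.re‖ ≤ ‖h‖ := Complex.abs_re_le_norm h
    simpa using this.trans (le_add_of_nonneg_right (norm_nonneg _))
  · exact le_add_of_nonneg_left (norm_nonneg _)

/-- The interior estimate is used again, now for the quotient `‖h‖⁻¹ • (U (z + h) - U z)`, which the
first use bounds by `L` independently of `h`. -/
theorem exists_second_difference_bound_of_solution {G : ℝ × ℂ → ℂ} (hG : ContDiff ℝ 2 G)
    (hper : ∀ p : ℝ × ℂ, G (p + (1, 0)) = G p) {C : ℝ} (hC : 0 ≤ C) :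
    ∃ K, 0 ≤ K ∧ ∀ U, IsBoundedDbarSolution G C U → ∀ h k z,
      ‖(U (z + k + h) - U (z + k)) - (U (z + h) - U z)‖ ≤ K * ‖k‖ * ‖h‖ := by
  obtain ⟨L, hL0, hL⟩ := exists_lipschitz_bound_of_solution hG hper hC
  obtain ⟨B, hB0, hB⟩ := exists_second_difference_bound hG hper C
  -- The factor `(1 + L) * (1 + L)` comes from two increments of `z ↦ (z.re, U z)`, in directions
  -- `h` and `k`.
  obtain ⟨K, hK0, hK⟩ := exists_lipschitz_bound_of_dbar_le (A := B * ((1 + L) * (1 + L))) (B := B)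
    (M := L) (by positivity) hB0 hL0
  refine ⟨K, hK0, fun U hU h k z => ?_⟩
  rcases eq_or_ne h 0 with rfl | hh
  · simp
  have hh' : 0 < ‖h‖ := norm_pos_iff.2 hh
  have hUd : Differentiable ℝ U := hU.contDiff.differentiable one_ne_zero
  have hP (j z : ℂ) : ‖((z + j).re, U (z + j)) - (z.re, U z)‖ ≤ (1 + L) * ‖j‖ := by
    have h1 : ‖j.re‖ ≤ ‖j‖ := Complex.abs_re_le_norm j
    have h2 := mul_nonneg hL0 (norm_nonneg j)
    rw [Prod.norm_def]
    refine max_le ?_ ((hL U hU j z).trans (by nlinarith [norm_nonneg j]))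
    simp only [Prod.mk_sub_mk, add_re, add_sub_cancel_left]
    linarith
  have hΔ : ContDiff ℝ 1 fun z => U (z + h) - U z :=
    (hU.contDiff.comp (contDiff_id.add contDiff_const)).sub hU.contDiff
  have hw : ContDiff ℝ 1 fun z => ‖h‖⁻¹ • (U (z + h) - U z) := hΔ.const_smul _
  have hdw (z : ℂ) : dbar (fun z => ‖h‖⁻¹ • (U (z + h) - U z)) z =
      ‖h‖⁻¹ • (G ((z + h).re, U (z + h)) - G (z.re, U z)) := by
    rw [dbar_const_smul (hΔ.differentiable one_ne_zero), dbar_add_right_sub hUd, hU.equation,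
      hU.equation]
  have key := hK _ hw (fun z => by
    rw [norm_smul, norm_inv, norm_norm, inv_mul_le_iff₀ hh', mul_comm]
    exact hL U hU h z) k (fun z => by
    rw [dbar_add_right_sub (hw.differentiable one_ne_zero), hdw, hdw, ← smul_sub, ← smul_sub,
      norm_smul, norm_smul, norm_inv, norm_norm, inv_mul_le_iff₀ hh']
    refine (hB _ _ _ _ (hU.bound _) (hU.bound _) (hU.bound _) (hU.bound _)).trans ?_
    -- The time coordinate is affine, so its second difference vanishes.
    have e : ((z + k + h).re, U (z + k + h)) - ((z + k).re, U (z + k)) -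
        (((z + h).re, U (z + h)) - (z.re, U z)) =
        (0, U (z + k + h) - U (z + k) - (U (z + h) - U z)) := by
      ext <;> simp
    rw [e, Prod.norm_mk, norm_zero, max_eq_right (norm_nonneg _)]
    have h3 := mul_le_mul (hP h z) (hP k z) (norm_nonneg _) (by positivity)
    have h4 := mul_le_mul_of_nonneg_left h3 hB0
    refine (add_le_add_right h4 _).trans (le_of_eq ?_)
    field_simp
    ring) z
  rw [← smul_sub, norm_smul, norm_inv, norm_norm, inv_mul_le_iff₀ hh'] at key
  linarith

/-! ### Passage to the limit. -/

/-- Pointwise limits of uniformly `C^{1,1}` functions are `C¹`, and the derivatives converge. -/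
theorem exists_hasFDerivAt_of_tendsto {ι : Type*} {l : Ultrafilter ι} {U : ι → ℂ → ℂ} {V : ℂ → ℂ}
    {L K : ℝ} (hU : ∀ᶠ i in l, ContDiff ℝ 1 (U i))
    (hL : ∀ᶠ i in l, ∀ h z, ‖U i (z + h) - U i z‖ ≤ L * ‖h‖) (hL0 : 0 ≤ L) (hK0 : 0 ≤ K)
    (hK : ∀ᶠ i in l, ∀ h k z,
      ‖(U i (z + k + h) - U i (z + k)) - (U i (z + h) - U i z)‖ ≤ K * ‖k‖ * ‖h‖)
    (hV : ∀ z, Tendsto (fun i => U i z) l (𝓝 (V z))) :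
    ContDiff ℝ 1 V ∧ ∀ z, Tendsto (fun i => fderiv ℝ (U i) z) l (𝓝 (fderiv ℝ V z)) := by
  have hD1 : ∀ᶠ i in l, ∀ z, ‖fderiv ℝ (U i) z‖ ≤ L := by
    filter_upwards [hU, hL] with i hi hLi z
    refine (hi.differentiable one_ne_zero z).hasFDerivAt.le_of_lip' hL0 (.of_forall fun x => ?_)
    simpa using hLi (x - z) z
  have hD2 : ∀ᶠ i in l, ∀ z k, ‖fderiv ℝ (U i) (z + k) - fderiv ℝ (U i) z‖ ≤ K * ‖k‖ := by
    filter_upwards [hU, hK] with i hi hKi z k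
    have hd := hi.differentiable one_ne_zero
    have h1 : HasFDerivAt (fun z => U i (z + k) - U i z)
        (fderiv ℝ (U i) (z + k) - fderiv ℝ (U i) z) z := by
      rw [← fderiv_comp_add_right, ← fderiv_fun_sub (by fun_prop) (by fun_prop)]
      exact DifferentiableAt.hasFDerivAt (by fun_prop)
    refine h1.le_of_lip' (by positivity) (.of_forall fun x => ?_)
    have h2 := hKi (x - z) k z
    rw [add_sub_cancel, show z + k + (x - z) = x + k by ring] at h2
    rwa [show U i (x + k) - U i x - (U i (z + k) - U i z) =
      U i (x + k) - U i (z + k) - (U i x - U i z) by ring]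
  have hT : ∀ᶠ i in l, ∀ z h, ‖U i (z + h) - U i z - fderiv ℝ (U i) z h‖ ≤ K * ‖h‖ * ‖h‖ := by
    filter_upwards [hU, hD2] with i hi hDi z h
    have hd := hi.differentiable one_ne_zero
    have h1 := (convex_closedBall z ‖h‖).norm_image_sub_le_of_norm_fderiv_le' (𝕜 := ℝ)
      (f := U i) (φ := fderiv ℝ (U i) z) (C := K * ‖h‖) (x := z) (y := z + h)
      (fun x _ => hd x) (fun x hx => by
        have h2 := hDi z (x - z)
        rw [add_sub_cancel] at h2
        refine h2.trans ?_
        gcongr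
        simpa [dist_eq_norm] using hx) (by simp) (by simp)
    simpa using h1
  -- Bounded derivatives lie in a compact ball of a finite-dimensional space, so the ultrafilter
  -- makes them converge without subsequences.
  have hlim (z : ℂ) : ∃ D, Tendsto (fun i => fderiv ℝ (U i) z) l (𝓝 D) := by
    have hc := isCompact_closedBall (0 : ℂ →L[ℝ] ℂ) L
    have hmem : ∀ᶠ i in l, fderiv ℝ (U i) z ∈ Metric.closedBall (0 : ℂ →L[ℝ] ℂ) L := by
      filter_upwards [hD1] with i hi
      simpa using hi z
    obtain ⟨D, -, hD⟩ := hc.ultrafilter_le_nhds (l.map fun i => fderiv ℝ (U i) z)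
      (le_principal_iff.2 hmem)
    exact ⟨D, hD⟩
  choose D hD using hlim
  -- The quadratic Taylor remainder is uniform in `i` and survives the limit.
  have hVD (z : ℂ) : HasFDerivAt V (D z) z := by
    have hq (h : ℂ) : ‖V (z + h) - V z - D z h‖ ≤ K * ‖h‖ * ‖h‖ := by
      have ht : Tendsto (fun i => ‖U i (z + h) - U i z - fderiv ℝ (U i) z h‖) l
          (𝓝 ‖V (z + h) - V z - D z h‖) :=
        (((hV _).sub (hV _)).sub (((continuous_eval_const h).tendsto (D z)).comp (hD z))).norm
      exact le_of_tendsto ht (hT.mono fun i hi => hi z h)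
    rw [hasFDerivAt_iff_isLittleO_nhds_zero]
    refine Asymptotics.IsBigO.trans_isLittleO (g := fun h : ℂ => ‖h‖ * ‖h‖)
      (Asymptotics.IsBigO.of_bound K (.of_forall fun h => ?_)) ?_
    · simpa [mul_assoc] using hq h
    · rw [Asymptotics.isLittleO_iff]
      intro ε hε
      filter_upwards [Metric.ball_mem_nhds (0 : ℂ) hε] with h hh
      rw [norm_mul, norm_norm]
      gcongr
      simpa using (mem_ball_zero_iff.1 hh).le
  have hfd (z : ℂ) : fderiv ℝ V z = D z := (hVD z).fderiv
  refine ⟨?_, fun z => by rw [hfd]; exact hD z⟩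
  rw [contDiff_one_iff_fderiv]
  refine ⟨fun z => (hVD z).differentiableAt, ?_⟩
  have hlip : LipschitzWith K.toNNReal (fderiv ℝ V) := by
    refine LipschitzWith.of_dist_le_mul fun x z => ?_
    rw [dist_eq_norm, dist_eq_norm, Real.coe_toNNReal _ hK0, hfd, hfd]
    refine le_of_tendsto ((hD x).sub (hD z)).norm (hD2.mono fun i hi => ?_)
    simpa using hi z (x - z)
  exact hlip.continuous

theorem isBoundedDbarSolution_of_tendsto {G : ℝ × ℂ → ℂ} (hG : ContDiff ℝ 2 G)
    (hper : ∀ p : ℝ × ℂ, G (p + (1, 0)) = G p) {C : ℝ} (hC : 0 ≤ C) {ι : Type*}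
    {l : Ultrafilter ι} {U : ι → ℂ → ℂ} {V : ℂ → ℂ}
    (hU : ∀ᶠ i in l, IsBoundedDbarSolution G C (U i))
    (hV : ∀ z, Tendsto (fun i => U i z) l (𝓝 (V z))) : IsBoundedDbarSolution G C V := by
  obtain ⟨L, hL0, hL⟩ := exists_lipschitz_bound_of_solution hG hper hC
  obtain ⟨K, hK0, hK⟩ := exists_second_difference_bound_of_solution hG hper hC
  obtain ⟨h1, h2⟩ := exists_hasFDerivAt_of_tendsto (hU.mono fun i hi => hi.contDiff)
    (hU.mono fun i hi => hL _ hi) hL0 hK0 (hU.mono fun i hi => hK _ hi) hV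
  refine ⟨h1, fun z => ?_, fun z => le_of_tendsto (hV z).norm (hU.mono fun i hi => hi.bound z)⟩
  have t1 : Tendsto (fun i => dbar (U i) z) l (𝓝 (dbar V z)) :=
    (((continuous_eval_const (1 : ℂ)).tendsto (fderiv ℝ V z)).comp (h2 z)).add
      ((((continuous_eval_const I).tendsto (fderiv ℝ V z)).comp (h2 z)).const_mul I)
  have t2 : Tendsto (fun i => G (z.re, U i z)) l (𝓝 (G (z.re, V z))) :=
    (hG.continuous.tendsto _).comp (tendsto_const_nhds.prodMk_nhds (hV z))
  exact tendsto_nhds_unique (t1.congr' (hU.mono fun i hi => hi.equation z)) t2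

/-! ### From the cylinder to the complex plane. -/

/-- The standard identification of `ℂ` with the plane. -/
noncomputable abbrev planeIso : ℂ ≃ₗᵢ[ℝ] Plane := Complex.orthonormalBasisOneI.repr

theorem sympJ_planeIso (w : ℂ) : sympJ (planeIso w) = planeIso (I * w) := by
  ext i
  fin_cases i <;> simp [sympJ, Matrix.toLpLin_apply]

/-- A function on the cylinder in the complex coordinate `t + i s`. -/
noncomputable def toPlanar (u : Cylinder → Plane) (z : ℂ) : ℂ :=
  planeIso.symm (u (z.im, (z.re : UnitAddCircle)))

/-- A vector field on the plane with values and arguments in `ℂ`. -/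
noncomputable def planarField (F : UnitAddCircle → Plane → Plane) (p : ℝ × ℂ) : ℂ :=
  planeIso.symm (F (p.1 : UnitAddCircle) (planeIso p.2))

theorem planeIso_toPlanar (u : Cylinder → Plane) (s t : ℝ) :
    planeIso (toPlanar u (t + s * I)) = u (s, (t : UnitAddCircle)) := by
  have h : toPlanar u (t + s * I) = planeIso.symm (u (s, (t : UnitAddCircle))) := by
    unfold toPlanar
    congr <;> simp
  rw [h, LinearIsometryEquiv.apply_symm_apply]

theorem contDiff_planarField {F : UnitAddCircle → Plane → Plane} (hF : IsSmoothField F) :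
    ContDiff ℝ 2 (planarField F) := by
  have hF2 : ContDiff ℝ 2 (fun p : ℝ × Plane => F (p.1 : UnitAddCircle) p.2) :=
    contDiff_infty.1 hF 2
  have h1 : ContDiff ℝ 2 fun p : ℝ × ℂ => (p.1, planeIso p.2) :=
    contDiff_fst.prodMk (planeIso.contDiff.comp contDiff_snd)
  exact planeIso.symm.contDiff.comp (hF2.comp h1)

theorem planarField_add (F : UnitAddCircle → Plane → Plane) (p : ℝ × ℂ) :
    planarField F (p + (1, 0)) = planarField F p := by
  simp [planarField]

theorem contDiff_toPlanar_iff {u : Cylinder → Plane} :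
    ContDiff ℝ 1 (toPlanar u) ↔ IsC1OnCylinder u := by
  constructor
  · intro h
    have h1 : ContDiff ℝ 1 fun p : ℝ × ℝ => (p.2 + p.1 * I : ℂ) :=
      (Complex.ofRealCLM.contDiff.comp contDiff_snd).add
        ((Complex.ofRealCLM.contDiff.comp contDiff_fst).mul contDiff_const)
    have h2 := planeIso.contDiff.comp (h.comp h1)
    unfold IsC1OnCylinder
    convert h2 using 1
    funext p
    exact (planeIso_toPlanar u p.1 p.2).symm
  · intro h
    exact planeIso.symm.contDiff.comp
      (h.comp (Complex.imCLM.contDiff.prodMk Complex.reCLM.contDiff))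

theorem partialS_eq {u : Cylinder → Plane} (hu : Differentiable ℝ (toPlanar u)) (s t : ℝ) :
    partialS u s t = planeIso (fderiv ℝ (toPlanar u) (t + s * I) I) := by
  have h1 : HasDerivAt (fun σ : ℝ => (t + σ * I : ℂ)) I s := by
    simpa using ((Complex.ofRealCLM.hasDerivAt (x := s)).mul_const I).const_add (t : ℂ)
  have h2 := (hu (t + s * I)).hasFDerivAt.comp_hasDerivAt s h1
  have h3 := (planeIso : ℂ →L[ℝ] Plane).hasFDerivAt.comp_hasDerivAt s h2
  exact (congrArg (deriv · s) (funext fun σ => (planeIso_toPlanar u σ t).symm)).trans h3.deriv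

theorem partialT_eq {u : Cylinder → Plane} (hu : Differentiable ℝ (toPlanar u)) (s t : ℝ) :
    partialT u s t = planeIso (fderiv ℝ (toPlanar u) (t + s * I) 1) := by
  have h1 : HasDerivAt (fun τ : ℝ => (τ + s * I : ℂ)) 1 t := by
    simpa using (Complex.ofRealCLM.hasDerivAt (x := t)).add_const (s * I : ℂ)
  have h2 := (hu (t + s * I)).hasFDerivAt.comp_hasDerivAt t h1
  have h3 := (planeIso : ℂ →L[ℝ] Plane).hasFDerivAt.comp_hasDerivAt t h2
  exact (congrArg (deriv · t) (funext fun τ => (planeIso_toPlanar u s τ).symm)).trans h3.deriv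

/-- `J` is multiplication by `i`; multiplying the equation by `i` gives the `dbar` form. -/
theorem equation_iff {F : UnitAddCircle → Plane → Plane} {u : Cylinder → Plane}
    (hu : Differentiable ℝ (toPlanar u)) (s t : ℝ) :
    partialS u s t -
        sympJ (partialT u s t - F (t : UnitAddCircle) (u (s, (t : UnitAddCircle)))) = 0 ↔
      dbar (toPlanar u) (t + s * I) = planarField F (t, toPlanar u (t + s * I)) := by
  have hF : F (t : UnitAddCircle) (u (s, (t : UnitAddCircle))) =
      planeIso (planarField F (t, toPlanar u (t + s * I))) := by
    simp only [planarField, planeIso_toPlanar, LinearIsometryEquiv.apply_symm_apply]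
  rw [partialS_eq hu, partialT_eq hu, hF, ← map_sub, sympJ_planeIso, ← map_sub,
    LinearIsometryEquiv.map_eq_zero_iff, dbar]
  have alg (a b g : ℂ) : a - I * (b - g) = 0 ↔ b + I * a = g := by
    constructor <;> intro h
    · linear_combination I * h + (b - g) * I_mul_I
    · linear_combination (-I) * h + a * I_mul_I
  exact alg _ _ _

theorem isBoundedCRSolution_iff {F : UnitAddCircle → Plane → Plane} {C : ℝ}
    {u : Cylinder → Plane} :
    IsBoundedCRSolution F C u ↔ IsBoundedDbarSolution (planarField F) C (toPlanar u) := by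
  constructor
  · intro h
    have hc := contDiff_toPlanar_iff.2 h.contDiff
    refine ⟨hc, fun z => ?_, fun z => ?_⟩
    · have := (equation_iff (hc.differentiable one_ne_zero) z.im z.re).1 (h.equation z.im z.re)
      rwa [Complex.re_add_im] at this
    · rw [toPlanar, LinearIsometryEquiv.norm_map]
      exact h.bound _
  · intro h
    refine ⟨contDiff_toPlanar_iff.1 h.contDiff, fun s t => ?_, ?_⟩
    · rw [equation_iff (h.contDiff.differentiable one_ne_zero)]
      simpa using h.equation (t + s * I)
    · rintro ⟨s, x⟩
      obtain ⟨t, rfl⟩ := QuotientAddGroup.mk_surjective x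
      have := h.bound (t + s * I)
      rwa [← planeIso.norm_map, planeIso_toPlanar] at this

theorem isBoundedCRSolution_of_tendsto {F : UnitAddCircle → Plane → Plane} (hF : IsSmoothField F)
    {C : ℝ} (hC : 0 ≤ C) {ι : Type*} {l : Ultrafilter ι} {u : ι → Cylinder → Plane}
    {v : Cylinder → Plane} (hu : ∀ᶠ i in l, IsBoundedCRSolution F C (u i))
    (hv : ∀ z, Tendsto (fun i => u i z) l (𝓝 (v z))) : IsBoundedCRSolution F C v := by
  rw [isBoundedCRSolution_iff]
  exact isBoundedDbarSolution_of_tendsto (contDiff_planarField hF) (planarField_add F) hC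
    (hu.mono fun i hi => isBoundedCRSolution_iff.1 hi)
    fun z => (planeIso.symm.continuous.tendsto _).comp (hv _)

/-! ### Compactness of the solution space. -/

theorem isOpenQuotientMap_cylinder :
    IsOpenQuotientMap (Prod.map id (↑) : ℝ × ℝ → Cylinder) :=
  IsOpenQuotientMap.id.prodMap QuotientAddGroup.isOpenQuotientMap_mk

theorem IsC1OnCylinder.continuous {u : Cylinder → Plane} (hu : IsC1OnCylinder u) :
    Continuous u :=
  isOpenQuotientMap_cylinder.isQuotientMap.continuous_iff.2 (ContDiff.continuous hu)

theorem equicontinuous_solutionSpace {F : UnitAddCircle → Plane → Plane} (hF : IsSmoothField F)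
    {C : ℝ} (hC : 0 ≤ C) :
    Equicontinuous ((↑) : solutionSpace F C → Cylinder → Plane) := by
  obtain ⟨L, hL0, hL⟩ :=
    exists_lipschitz_bound_of_solution (contDiff_planarField hF) (planarField_add F) hC
  intro z
  obtain ⟨⟨s, t⟩, rfl⟩ := isOpenQuotientMap_cylinder.surjective z
  rw [Metric.equicontinuousAt_iff_right]
  intro ε hε
  -- The covering is open, so neighbourhoods, and with them the uniform Lipschitz bound, descend to
  -- the cylinder.
  rw [← isOpenQuotientMap_cylinder.isOpenMap.map_nhds_eq
    isOpenQuotientMap_cylinder.continuous.continuousAt, eventually_map]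
  have hcont : Tendsto (fun p : ℝ × ℝ => L * ‖(p.2 + p.1 * I : ℂ) - (t + s * I)‖) (𝓝 (s, t))
      (𝓝 0) := by
    have h : Continuous fun p : ℝ × ℝ => L * ‖(p.2 + p.1 * I : ℂ) - (t + s * I)‖ := by fun_prop
    simpa using h.tendsto (s, t)
  filter_upwards [hcont.eventually_lt_const hε] with p hp u
  have h := hL _ (isBoundedCRSolution_iff.1 u.2) ((p.2 + p.1 * I : ℂ) - (t + s * I)) (t + s * I)
  rw [add_sub_cancel, ← planeIso.norm_map, map_sub, planeIso_toPlanar, planeIso_toPlanar] at h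
  rw [dist_comm, dist_eq_norm]
  exact h.trans_lt hp

/-- This is compactness for pointwise convergence: a closed subset of a product of closed balls. -/
theorem isCompact_setOf_isBoundedCRSolution {F : UnitAddCircle → Plane → Plane}
    (hF : IsSmoothField F) {C : ℝ} (hC : 0 ≤ C) : IsCompact {u | IsBoundedCRSolution F C u} := by
  refine (isCompact_univ_pi fun _ : Cylinder => isCompact_closedBall (0 : Plane) C).of_isClosed_subset
    ?_ fun u hu z _ => by simpa using hu.bound z
  rw [isClosed_iff_ultrafilter]
  intro v l hl hmem
  exact isBoundedCRSolution_of_tendsto hF hC (l := l) (u := id) hmem (tendsto_pi_nhds.1 hl)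

theorem isCompact_solutionSpace {F : UnitAddCircle → Plane → Plane}
    (hF : IsSmoothField F) {C : ℝ} (hC : 0 ≤ C) : IsCompact (solutionSpace F C) := by
  refine ArzelaAscoli.isCompact_of_equicontinuous _ ?_ (equicontinuous_solutionSpace hF hC)
  convert isCompact_setOf_isBoundedCRSolution hF hC using 1
  ext u
  constructor
  · rintro ⟨w, hw, rfl⟩
    exact hw
  · exact fun hu => ⟨⟨u, hu.contDiff.continuous⟩, hu, rfl⟩

theorem mainTheorem7 (F : UnitAddCircle → Plane → Plane) (hF : IsSmoothField F)
    (C : ℝ) (hC : 0 < C) :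
    CompactSpace (solutionSpace F C) ∧ T2Space (solutionSpace F C) ∧
      ∀ (u : ℕ → Cylinder → Plane) (v : Cylinder → Plane),
        (∀ n, IsBoundedCRSolution F C (u n)) →
        (∀ K : Set Cylinder, IsCompact K → TendstoUniformlyOn u v Filter.atTop K) →
        IsBoundedCRSolution F C v := by
  refine ⟨isCompact_iff_compactSpace.1 (isCompact_solutionSpace hF hC.le), inferInstance,
    fun u v hu huv => ?_⟩
  -- Only pointwise convergence is used, along any ultrafilter finer than `atTop`.
  refine isBoundedCRSolution_of_tendsto hF hC.le (l := hyperfilter ℕ) (.of_forall hu) fun z => ?_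
  exact ((huv {z} isCompact_singleton).tendsto_at rfl).mono_left
    (Nat.hyperfilter_le_atTop)
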